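/- Let $L$ be a (real) Banach lattice with order continuous norm and let $P$ be a positive idempotent operator on $L$ of finite rank $r$. Then there exist pairwise disjoint bands $B_1,B_2,B_3$ in $L$ with $L=B_1\oplus B_2\oplus B_3$, positive operators $X\colon B_2\to B_1$ and $Y\colon B_3\to B_2$, and an operator $Q$ on $B_2$ such that, with respect to this decomposition, $$ P=\begin{bmatrix}0&XQ&XQY\\0&Q&QY\\0&0&0\end{bmatrix} =\begin{bmatrix}X\\I\\0\end{bmatrix}\,Q\,\begin{bmatrix}0&I&Y\end{bmatrix}, $$ where $Q$ is an idempotent of rank $r$ such that $Q$ and its adjoint $Q^*$ are strictly positive operators on $B_2$ and on the dual space $B_2^*$, respectively. Moreover, there exist pairwise disjoint bands $L_1,\dots,L_r$ in $B_2$ with $B_2=L_1\oplus\cdots\oplus L_r$ such that $Q=Q_1\oplus\cdots\oplus Q_r$, where each $Q_j$ is a strictly positive idempotent of rank one on $L_j$. If, in addition, $P$ is ideal-triangularizable, then $B_2$ is finite-dimensional and $Q$ is the identity operator on $B_2$. Here an ideal is a linear subspace $J$ such that $|x|\le|y|$ and $y\in J$ imply $x\in J$; a band is an order closed ideal; the norm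 is order continuous if every decreasing net with infimum $0$ converges to $0$ in norm. All operators are continuous and linear; $T$ is positive if it maps positive vectors to positive vectors, and a positive $T$ is strictly positive if $T|x|=0$ implies $x=0$. The operator $P$ is ideal-triangularizable if some chain that is maximal among the chains of closed ideals of $L$ consists of ideals invariant under $P$. -/

import Mathlib

open Filter Topology

namespace RieszOp

universe u

/-- A decreasing net in an ordered additive group with infimum `0` (written `y ↓ 0`). -/
def DecreasesToZero {L : Type*} [Preorder L] [Zero L] {ι : Type*} [Preorder ι]
    (y : ι → L) : Prop :=
  Antitone y ∧ IsGLB (Set.range y) 0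

/-- The norm of a normed Riesz space `L` is order continuous: every decreasing net with infimum `0`
converges to `0` in norm.  (Nets indexed by types in the universe of `L` suffice, since the range of
a decreasing net is a downward directed subset of `L`.) -/
def HasOrderContinuousNorm (L : Type u) [NormedAddCommGroup L] [Lattice L] : Prop :=
  ∀ (ι : Type u) [Preorder ι] [IsDirectedOrder ι] [Nonempty ι] (y : ι → L),
    DecreasesToZero y → Tendsto y atTop (𝓝 0)

section Ideals

variable {L : Type u} [NormedAddCommGroup L] [Lattice L] [NormedSpace ℝ L]

/-- A linear subspace `J` is an ideal if `|x| ≤ |y|` and `y ∈ J` imply `x ∈ J`. -/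
def IsRieszIdeal (J : Submodule ℝ L) : Prop :=
  ∀ x y : L, |x| ≤ |y| → y ∈ J → x ∈ J

/-- Norm-closed ideals. -/
def IsClosedIdeal (J : Submodule ℝ L) : Prop :=
  IsRieszIdeal J ∧ IsClosed (J : Set L)

/-- The net `x` converges in order to `a`: it satisfies `|x i - a| ≤ y i` for a net `y ↓ 0`. -/
def OrderConverges {ι : Type*} [Preorder ι] (x : ι → L) (a : L) : Prop :=
  ∃ y : ι → L, DecreasesToZero y ∧ ∀ i, |x i - a| ≤ y i

/-- A band is an order closed ideal. -/
def IsBand (B : Submodule ℝ L) : Prop :=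
  IsRieszIdeal B ∧
    ∀ (ι : Type u) [Preorder ι] [IsDirectedOrder ι] [Nonempty ι] (x : ι → L) (a : L),
      (∀ i, x i ∈ B) → OrderConverges x a → a ∈ B

/-- `M` is the direct sum of the pairwise disjoint bands `B i`.  When `M` is a band of `L`, the bands
of the Riesz space `M` are exactly the bands of `L` contained in `M`. -/
def IsBandDecomposition {ι : Type*} (B : ι → Submodule ℝ L) (M : Submodule ℝ L) : Prop :=
  (∀ i, IsBand (B i)) ∧
    (∀ i j, i ≠ j → ∀ x ∈ B i, ∀ y ∈ B j, |x| ⊓ |y| = 0) ∧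
    iSupIndep B ∧ ⨆ i, B i = M

/-- A family of operators is ideal-triangularizable if some chain that is maximal among the chains
of closed ideals consists of ideals invariant under all members of the family. -/
def IsIdealTriangularizable (F : Set (L →L[ℝ] L)) : Prop :=
  ∃ C : Set (Submodule ℝ L),
    Maximal (fun D : Set (Submodule ℝ L) => IsChain (· ≤ ·) D ∧ ∀ J ∈ D, IsClosedIdeal J) C ∧
      ∀ J ∈ C, ∀ T ∈ F, ∀ x ∈ J, T x ∈ J

end Ideals

section Operators

variable {E F : Type*} [NormedAddCommGroup E] [PartialOrder E] [NormedSpace ℝ E]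
  [NormedAddCommGroup F] [PartialOrder F] [NormedSpace ℝ F]

/-- Positive operators. -/
def IsPositiveOp (T : E →L[ℝ] F) : Prop :=
  ∀ x : E, 0 ≤ x → 0 ≤ T x

/-- Strictly positive operators: the absolute kernel `{x | T |x| = 0}` of the positive operator `T`
is zero, i.e. `T` annihilates no nonzero positive vector. -/
def IsStrictlyPositiveOp (T : E →L[ℝ] F) : Prop :=
  IsPositiveOp T ∧ ∀ x : E, 0 ≤ x → T x = 0 → x = 0

/-- The adjoint `T* : F* → E*`, `φ ↦ φ ∘ T`. -/
noncomputable def adjointOp (T : E →L[ℝ] F) : StrongDual ℝ F →L[ℝ] StrongDual ℝ E :=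
  ContinuousLinearMap.precomp ℝ T

/-- Positive functionals: the positive cone of the dual space. -/
def IsPositiveFunctional (φ : StrongDual ℝ E) : Prop :=
  ∀ x : E, 0 ≤ x → 0 ≤ φ x

/-- An operator between dual spaces is strictly positive for the orders given by the cones of
positive functionals. -/
def IsStrictlyPositiveDualOp (S : StrongDual ℝ F →L[ℝ] StrongDual ℝ E) : Prop :=
  (∀ φ, IsPositiveFunctional φ → IsPositiveFunctional (S φ)) ∧
    ∀ φ, IsPositiveFunctional φ → S φ = 0 → φ = 0

end Operators

end RieszOp

open RieszOp

/-! Take `B₁ = N`, the absolute kernel `{x | P |x| = 0}`, let `R` be the closed ideal generated by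
the range of `P`, and put `B₂ = Nᵈ ∩ R`, `B₃ = Nᵈ ∩ Rᵈ`. Order continuity turns every closed ideal
into a projection band (`IsClosedIdeal.exists_bandProjection`), so these three bands decompose `L`.
Since `P` kills `N` and maps into `R ⊆ N + B₂`, it splits as `P = A + D` with `A` into `N` and `D`
into `B₂`. Then `P A = 0`, hence `P D = P`, `A D = A`, `D D = D`, and `X`, `Q`, `Y` are restrictions
of `A`, `D`, `D`.

Strict positivity of `D` on `B₂` makes its range a sublattice: if `x = D x`, then `|x| ≤ D |x|` and
`D` kills the difference. A finite-dimensional sublattice has a basis of disjoint positive vectors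
(`exists_isDisjointFamily_span_eq`). The closed ideals these vectors generate are the bands `L_j`
(`exists_disjoint_fixed_basis`).

If `P` is ideal-triangularizable, a chain member meeting `L_j` nontrivially must contain the basis
vector `e j`. Maximality of the chain then leaves no room for two disjoint nonzero vectors in `L_j`
(`closedIdealSpan_le_span_of_maximal_chain`), so `L_j` is a line fixed by `Q`. -/

set_option linter.unusedSectionVars false

namespace RieszOp

universe u

/-! ### Disjointness in vector lattices. -/

section RieszSpace

variable {E : Type*} [Lattice E] [AddCommGroup E] [IsOrderedAddMonoid E]

theorem add_inf_eq_zero {a b c : E} (ha : 0 ≤ a) (hb : 0 ≤ b) (hc : 0 ≤ c)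
    (hac : a ⊓ c = 0) (hbc : b ⊓ c = 0) : (a + b) ⊓ c = 0 := by
  refine le_antisymm ?_ (le_inf (add_nonneg ha hb) hc)
  rw [← hac]
  refine le_inf ?_ inf_le_right
  rw [← sub_nonpos, ← hbc]
  refine le_inf ?_ ?_
  · rw [sub_le_iff_le_add']
    exact inf_le_left
  · rw [sub_le_iff_le_add]
    exact inf_le_right.trans (le_add_of_nonneg_right ha)

theorem inf_abs_eq_zero_of_le {x y z : E} (hxy : |x| ≤ |y|) (h : |y| ⊓ |z| = 0) :
    |x| ⊓ |z| = 0 :=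
  le_antisymm (h ▸ inf_le_inf_right _ hxy) (le_inf (abs_nonneg _) (abs_nonneg _))

theorem eq_zero_of_abs_inf_self {x : E} (h : |x| ⊓ |x| = 0) : x = 0 := by
  rw [inf_idem] at h
  exact le_antisymm (h ▸ le_abs_self x) (neg_nonpos.1 (h ▸ neg_le_abs x))

theorem eq_zero_of_abs_eq_zero {x : E} (h : |x| = 0) : x = 0 :=
  eq_zero_of_abs_inf_self (by rw [h, inf_idem])

variable [Module ℝ E] [IsOrderedModule ℝ E]

theorem abs_smul_le (c : ℝ) (x : E) : |c • x| ≤ |c| • |x| := by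
  rw [abs_le']
  rcases le_total 0 c with hc | hc
  · rw [abs_of_nonneg hc, ← smul_neg]
    exact ⟨smul_le_smul_of_nonneg_left (le_abs_self x) hc,
      smul_le_smul_of_nonneg_left (neg_le_abs x) hc⟩
  · rw [abs_of_nonpos hc]
    have h : 0 ≤ -c := neg_nonneg.2 hc
    refine ⟨?_, ?_⟩
    · simpa using smul_le_smul_of_nonneg_left (neg_le_abs x) h
    · simpa using smul_le_smul_of_nonneg_left (le_abs_self x) h

theorem smul_inf_eq_zero {a b : E} {c : ℝ} (hc : 0 ≤ c) (ha : 0 ≤ a) (hb : 0 ≤ b)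
    (hab : a ⊓ b = 0) : (c • a) ⊓ b = 0 := by
  refine le_antisymm ?_ (le_inf (smul_nonneg hc ha) hb)
  set w := (c • a) ⊓ b with hw
  -- Dividing by `max c 1` rather than by `c` puts the quotient below `b` as well as below `a`, and
  -- covers `c = 0`.
  have hd : 0 < max c 1 := lt_max_of_lt_right one_pos
  have hw0 : 0 ≤ w := le_inf (smul_nonneg hc ha) hb
  have h1 : (max c 1)⁻¹ • w ≤ a := by
    rw [inv_smul_le_iff_of_pos hd]
    exact inf_le_left.trans (smul_le_smul_of_nonneg_right (le_max_left _ _) ha)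
  have h2 : (max c 1)⁻¹ • w ≤ b := by
    rw [inv_smul_le_iff_of_pos hd]
    exact inf_le_right.trans (le_smul_of_one_le_left hb (le_max_right _ _))
  have h3 : (max c 1)⁻¹ • w ≤ 0 := hab ▸ le_inf h1 h2
  rw [inv_smul_le_iff_of_pos hd, smul_zero] at h3
  exact h3

end RieszSpace

/-! ### Closed ideals, disjoint complements and absolute kernels in normed Riesz spaces. -/

section NormedRieszSpace

variable {L : Type u} [NormedAddCommGroup L] [Lattice L] [HasSolidNorm L]
  [IsOrderedAddMonoid L] [NormedSpace ℝ L] [IsOrderedModule ℝ L]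

theorem IsRieszIdeal.abs_mem {J : Submodule ℝ L} (hJ : IsRieszIdeal J) {x : L} (hx : x ∈ J) :
    |x| ∈ J := hJ _ x (by rw [abs_abs]) hx

theorem IsRieszIdeal.mem_of_le {J : Submodule ℝ L} (hJ : IsRieszIdeal J) {x y : L}
    (hx : 0 ≤ x) (hxy : x ≤ y) (hy : y ∈ J) : x ∈ J :=
  hJ x y (by rwa [abs_of_nonneg hx, abs_of_nonneg (hx.trans hxy)]) hy

/-- The disjoint complement of a set. -/
def disjointCompl (S : Set L) : Submodule ℝ L where
  carrier := {x | ∀ y ∈ S, |x| ⊓ |y| = 0}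
  add_mem' {a b} ha hb y hy := by
    have h := add_inf_eq_zero (abs_nonneg a) (abs_nonneg b) (abs_nonneg y) (ha y hy) (hb y hy)
    refine inf_abs_eq_zero_of_le (y := |a| + |b|) ?_ ?_
    · rw [abs_of_nonneg (add_nonneg (abs_nonneg a) (abs_nonneg b))]
      exact abs_add_le a b
    · rwa [abs_of_nonneg (add_nonneg (abs_nonneg a) (abs_nonneg b))]
  zero_mem' y _ := by rw [abs_zero]; exact inf_of_le_left (abs_nonneg y)
  smul_mem' c x hx y hy := by
    have h := smul_inf_eq_zero (abs_nonneg c) (abs_nonneg x) (abs_nonneg y) (hx y hy)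
    have h0 : 0 ≤ |c| • |x| := smul_nonneg (abs_nonneg c) (abs_nonneg x)
    refine inf_abs_eq_zero_of_le (y := |c| • |x|) ?_ ?_
    · rw [abs_of_nonneg h0]
      exact abs_smul_le c x
    · rwa [abs_of_nonneg h0]

theorem mem_disjointCompl {S : Set L} {x : L} :
    x ∈ disjointCompl S ↔ ∀ y ∈ S, |x| ⊓ |y| = 0 := Iff.rfl

theorem mem_disjointCompl_singleton {x y : L} :
    x ∈ disjointCompl {y} ↔ |x| ⊓ |y| = 0 := by simp [mem_disjointCompl]

theorem disjointCompl_isClosedIdeal (S : Set L) : IsClosedIdeal (disjointCompl S) := by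
  refine ⟨fun x y hxy hy z hz => inf_abs_eq_zero_of_le hxy (hy z hz), ?_⟩
  have h : (disjointCompl S : Set L) = ⋂ y ∈ S, {x : L | |x| ⊓ |y| = 0} := by
    ext x
    simp [mem_disjointCompl]
  rw [h]
  refine isClosed_biInter fun y _ => isClosed_eq ?_ continuous_const
  exact (continuous_id.sup continuous_neg).inf continuous_const

theorem le_disjointCompl_symm {J K : Submodule ℝ L} (h : J ≤ disjointCompl (K : Set L)) :
    K ≤ disjointCompl (J : Set L) := fun x hx y hy => by
  rw [inf_comm]
  exact h hy x hx

theorem eq_zero_of_mem_disjointCompl {J : Submodule ℝ L} {x : L} (hx : x ∈ J)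
    (hx' : x ∈ disjointCompl (J : Set L)) : x = 0 :=
  eq_zero_of_abs_inf_self (hx' x hx)

theorem IsClosedIdeal.inf {J K : Submodule ℝ L} (hJ : IsClosedIdeal J) (hK : IsClosedIdeal K) :
    IsClosedIdeal (J ⊓ K) :=
  ⟨fun x y hxy hy => ⟨hJ.1 x y hxy hy.1, hK.1 x y hxy hy.2⟩, hJ.2.inter hK.2⟩

/-- The closed ideal generated by a set. -/
def closedIdealSpan (S : Set L) : Submodule ℝ L :=
  sInf {J | IsClosedIdeal J ∧ S ⊆ J}

theorem closedIdealSpan_isClosedIdeal (S : Set L) : IsClosedIdeal (closedIdealSpan S) := by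
  constructor
  · intro x y hxy hy
    simp only [closedIdealSpan, Submodule.mem_sInf] at hy ⊢
    exact fun J hJ => hJ.1.1 x y hxy (hy J hJ)
  · rw [closedIdealSpan, Submodule.coe_sInf]
    exact isClosed_biInter fun J hJ => hJ.1.2

theorem subset_closedIdealSpan (S : Set L) : S ⊆ closedIdealSpan S := fun x hx => by
  simp only [closedIdealSpan, SetLike.mem_coe, Submodule.mem_sInf]
  exact fun J hJ => hJ.2 hx

theorem closedIdealSpan_le {S : Set L} {J : Submodule ℝ L} (hJ : IsClosedIdeal J)
    (hS : S ⊆ J) : closedIdealSpan S ≤ J := sInf_le ⟨hJ, hS⟩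

theorem mem_closedIdealSpan_singleton (x : L) : x ∈ closedIdealSpan {x} :=
  subset_closedIdealSpan _ rfl

/-- Disjoint complements are closed ideals, so disjointness passes from generators to the ideals,
one side at a time. -/
theorem closedIdealSpan_singleton_le_disjointCompl {x y : L} (h : |x| ⊓ |y| = 0) :
    closedIdealSpan {x} ≤ disjointCompl (closedIdealSpan {y} : Set L) := by
  have h1 : closedIdealSpan {x} ≤ disjointCompl {y} :=
    closedIdealSpan_le (disjointCompl_isClosedIdeal _)
      (Set.singleton_subset_iff.2 (mem_disjointCompl_singleton.2 h))
  refine le_disjointCompl_symm (closedIdealSpan_le (disjointCompl_isClosedIdeal _) ?_)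
  rw [Set.singleton_subset_iff]
  intro z hz
  rw [inf_comm]
  exact mem_disjointCompl_singleton.1 (h1 hz)

variable {F : Type*} [NormedAddCommGroup F] [Lattice F] [HasSolidNorm F]
  [IsOrderedAddMonoid F] [NormedSpace ℝ F] [IsOrderedModule ℝ F]

theorem IsPositiveOp.mono {T : L →L[ℝ] F} (hT : IsPositiveOp T) {x y : L} (h : x ≤ y) :
    T x ≤ T y := by
  have := hT (y - x) (sub_nonneg.2 h)
  rwa [map_sub, sub_nonneg] at this

theorem IsPositiveOp.abs_le {T : L →L[ℝ] F} (hT : IsPositiveOp T) (x : L) :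
    |T x| ≤ T |x| := by
  rw [abs_le', ← map_neg]
  exact ⟨hT.mono (le_abs_self x), hT.mono (neg_le_abs x)⟩

/-- The closed ideal of all `x` such that `T |x|` belongs to the closed ideal `J`. -/
def absComap (T : L →L[ℝ] F) (hT : IsPositiveOp T) (J : Submodule ℝ F) (hJ : IsClosedIdeal J) :
    Submodule ℝ L where
  carrier := {x | T |x| ∈ J}
  add_mem' {a b} ha hb := by
    refine hJ.1.mem_of_le (hT _ (abs_nonneg _)) (hT.mono (abs_add_le a b)) ?_
    rw [map_add]
    exact J.add_mem ha hb
  zero_mem' := by simp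
  smul_mem' c x hx := by
    refine hJ.1.mem_of_le (hT _ (abs_nonneg _)) (hT.mono (abs_smul_le c x)) ?_
    rw [map_smul]
    exact J.smul_mem _ hx

theorem mem_absComap {T : L →L[ℝ] F} {hT : IsPositiveOp T} {J : Submodule ℝ F}
    {hJ : IsClosedIdeal J} {x : L} : x ∈ absComap T hT J hJ ↔ T |x| ∈ J := Iff.rfl

theorem absComap_isClosedIdeal (T : L →L[ℝ] F) (hT : IsPositiveOp T) (J : Submodule ℝ F)
    (hJ : IsClosedIdeal J) : IsClosedIdeal (absComap T hT J hJ) :=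
  ⟨fun _ _ hxy hy => hJ.1.mem_of_le (hT _ (abs_nonneg _)) (hT.mono hxy) hy,
    hJ.2.preimage (T.continuous.comp (continuous_id.sup continuous_neg))⟩

theorem bot_isClosedIdeal : IsClosedIdeal (⊥ : Submodule ℝ F) := by
  refine ⟨fun x y hxy hy => ?_, by simp⟩
  rw [Submodule.mem_bot] at hy ⊢
  rw [hy, abs_zero] at hxy
  exact eq_zero_of_abs_eq_zero (le_antisymm hxy (abs_nonneg x))

/-- Connectedness of `ℝ`: the closed sets of `t` with `t • e ≤ x` and with `x ≤ t • e` cover the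
line, so they meet once both are nonempty. If `0 ≤ t` and `t • e ≤ |x|`, then `t ≤ ‖x‖ / ‖e‖`; hence
the points `±(‖x‖ / ‖e‖ + 1)` witness nonemptiness. -/
theorem exists_smul_eq_of_forall_le_or_le {e x : L} (he : 0 ≤ e) (he0 : e ≠ 0)
    (h : ∀ t : ℝ, t • e ≤ x ∨ x ≤ t • e) : ∃ t : ℝ, t • e = x := by
  have hn : 0 < ‖e‖ := norm_pos_iff.2 he0
  have key : ∀ t : ℝ, 0 ≤ t → t • e ≤ |x| → t ≤ ‖x‖ / ‖e‖ := fun t ht hle => by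
    rw [le_div_iff₀ hn]
    have h1 : ‖t • e‖ ≤ ‖x‖ := norm_le_norm_of_abs_le_abs (by
      rwa [abs_of_nonneg (smul_nonneg ht he)])
    rwa [norm_smul, Real.norm_of_nonneg ht] at h1
  have hpos : (0 : ℝ) ≤ ‖x‖ / ‖e‖ + 1 := by positivity
  have hnot : ¬ (‖x‖ / ‖e‖ + 1) • e ≤ |x| := fun hle => by
    have := key _ hpos hle
    linarith
  have hc : Continuous fun t : ℝ => t • e := by fun_prop
  obtain ⟨t, -, ht1, ht2⟩ := isPreconnected_closed_iff.1 isPreconnected_univ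
    {t : ℝ | t • e ≤ x} {t : ℝ | x ≤ t • e} (isClosed_le hc continuous_const)
    (isClosed_le continuous_const hc) (fun t _ => h t)
    ⟨-(‖x‖ / ‖e‖ + 1), trivial, (h _).resolve_right fun hle => hnot <| by
      rw [neg_smul, le_neg] at hle
      exact hle.trans (neg_le_abs x)⟩
    ⟨‖x‖ / ‖e‖ + 1, trivial, (h _).resolve_left fun hle => hnot (hle.trans (le_abs_self x))⟩
  exact ⟨t, le_antisymm ht1 ht2⟩

theorem iSupIndep_of_pairwise_disjoint {ι : Type*} {B : ι → Submodule ℝ L}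
    (h : ∀ i j, i ≠ j → ∀ x ∈ B i, ∀ y ∈ B j, |x| ⊓ |y| = 0) : iSupIndep B := by
  intro i
  rw [Submodule.disjoint_def]
  intro x hx hx'
  have hle : ⨆ j, ⨆ (_ : j ≠ i), B j ≤ disjointCompl (B i : Set L) :=
    iSup₂_le fun j hj y hy z hz => h j i hj y hy z hz
  exact eq_zero_of_mem_disjointCompl hx (hle hx')

theorem linearIndependent_of_pairwise_disjoint {ι : Type*} {e : ι → L} (he : ∀ i, e i ≠ 0)
    (h : ∀ i j, i ≠ j → |e i| ⊓ |e j| = 0) : LinearIndependent ℝ e := by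
  refine (iSupIndep_of_pairwise_disjoint (B := fun i => closedIdealSpan {e i})
    fun i j hij x hx y hy => ?_).linearIndependent _
    (fun i => mem_closedIdealSpan_singleton (e i)) he
  exact closedIdealSpan_singleton_le_disjointCompl (h i j hij) hx y hy

end NormedRieszSpace

/-! ### Order continuous norm: suprema of directed sets and band projections. -/

section OrderContinuousNorm

variable {L : Type u} [NormedAddCommGroup L] [Lattice L] [HasSolidNorm L]
  [IsOrderedAddMonoid L] [NormedSpace ℝ L] [IsOrderedModule ℝ L]

theorem IsClosedIdeal.isBand (hL : HasOrderContinuousNorm L) {J : Submodule ℝ L}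
    (hJ : IsClosedIdeal J) : IsBand J := by
  refine ⟨hJ.1, fun ι _ _ _ x a hx ⟨y, hy, hxy⟩ => ?_⟩
  have hy0 := hL ι y hy
  have h : Tendsto x atTop (𝓝 a) := by
    rw [tendsto_iff_norm_sub_tendsto_zero]
    refine squeeze_zero (fun _ => norm_nonneg _) (fun i => ?_) (tendsto_norm_zero.comp hy0)
    exact norm_le_norm_of_abs_le_abs ((hxy i).trans (le_abs_self _))
  exact hJ.2.mem_of_tendsto h (Eventually.of_forall hx)

theorem eq_zero_of_forall_nsmul_le {z w : L} (hz : 0 ≤ z) (h : ∀ n : ℕ, n • z ≤ w) : z = 0 := by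
  by_contra hne
  have hn : 0 < ‖z‖ := norm_pos_iff.2 hne
  obtain ⟨n, hn'⟩ := exists_nat_gt (‖w‖ / ‖z‖)
  rw [div_lt_iff₀ hn] at hn'
  have h1 : ‖n • z‖ ≤ ‖w‖ := norm_le_norm_of_abs_le_abs (by
    rw [abs_of_nonneg (nsmul_nonneg hz n)]
    exact (h n).trans (le_abs_self w))
  rw [← Nat.cast_smul_eq_nsmul ℝ, norm_smul, Real.norm_of_nonneg n.cast_nonneg] at h1
  linarith

/-- No supremum of `S` is needed. If a positive vector lies below every difference, subtracting it
from an upper bound gives another upper bound; iterating contradicts the Archimedean property unless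
the vector is zero. -/
theorem isGLB_upperBounds_sub {S : Set L} (hne : S.Nonempty) (hb : BddAbove S) :
    IsGLB (Set.range fun i : S × (upperBounds S)ᵒᵈ => (OrderDual.ofDual i.2).1 - i.1) 0 := by
  constructor
  · rintro _ ⟨⟨a, u⟩, rfl⟩
    exact sub_nonneg.2 (u.2 a.2)
  · intro w hw
    obtain ⟨a, ha⟩ := hne
    obtain ⟨u, hu⟩ := hb
    have hw' : ∀ v ∈ upperBounds S, ∀ b ∈ S, w ⊔ 0 ≤ v - b := fun v hv b hb =>
      sup_le (hw ⟨(⟨b, hb⟩, OrderDual.toDual ⟨v, hv⟩), rfl⟩) (sub_nonneg.2 (hv hb))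
    have hstep : ∀ n : ℕ, u - n • (w ⊔ 0) ∈ upperBounds S := by
      intro n
      induction n with
      | zero => simpa using hu
      | succ n ih =>
        intro b hb
        have := hw' _ ih b hb
        rw [succ_nsmul, ← sub_sub]
        exact le_sub_comm.1 this
    have h0 : w ⊔ 0 = 0 := eq_zero_of_forall_nsmul_le (w := u - a) le_sup_right
      fun n => le_sub_comm.1 (hstep n ha)
    exact sup_eq_right.1 h0

variable [CompleteSpace L]

/-- The differences "upper bound minus element" decrease to `0`, hence tend to `0` in norm. They
dominate the increments of `S`, which is therefore a Cauchy net, and its norm limit is the supremum.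
-/
theorem exists_isLUB_mem_closure (hL : HasOrderContinuousNorm L) {S : Set L} (hne : S.Nonempty)
    (hdir : DirectedOn (· ≤ ·) S) (hb : BddAbove S) : ∃ s ∈ closure S, IsLUB S s := by
  have : Nonempty S := hne.to_subtype
  have : Nonempty (upperBounds S)ᵒᵈ := let ⟨u, hu⟩ := hb; ⟨OrderDual.toDual ⟨u, hu⟩⟩
  have hdirI : IsDirectedOrder (S × (upperBounds S)ᵒᵈ) := by
    constructor
    rintro ⟨a, u⟩ ⟨b, v⟩
    obtain ⟨c, hc, hac, hbc⟩ := hdir a a.2 b b.2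
    refine ⟨(⟨c, hc⟩, OrderDual.toDual ⟨(OrderDual.ofDual u).1 ⊓ (OrderDual.ofDual v).1,
      fun x hx => le_inf ((OrderDual.ofDual u).2 hx) ((OrderDual.ofDual v).2 hx)⟩), ?_, ?_⟩
    · exact ⟨hac, OrderDual.le_toDual.2 (Subtype.coe_le_coe.1 inf_le_left)⟩
    · exact ⟨hbc, OrderDual.le_toDual.2 (Subtype.coe_le_coe.1 inf_le_right)⟩
  have hy := hL (S × (upperBounds S)ᵒᵈ) (fun i => (OrderDual.ofDual i.2).1 - i.1)
    ⟨fun i j hij => sub_le_sub (show ((OrderDual.ofDual j.2 : upperBounds S) : L) ≤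
      (OrderDual.ofDual i.2 : upperBounds S) from hij.2) hij.1, isGLB_upperBounds_sub hne hb⟩
  have hcau : Cauchy (map (fun i : S × (upperBounds S)ᵒᵈ => (i.1 : L)) atTop) := by
    rw [Metric.cauchy_iff]
    refine ⟨inferInstance, fun ε hε => ?_⟩
    obtain ⟨⟨a₀, u₀⟩, h₀⟩ := ((Metric.tendsto_nhds.1 hy) (ε / 2) (half_pos hε)).exists
    rw [dist_zero_right] at h₀
    refine ⟨_, image_mem_map (Ici_mem_atTop (a₀, u₀)), ?_⟩
    have key : ∀ i : S × (upperBounds S)ᵒᵈ, (a₀, u₀) ≤ i → dist (i.1 : L) a₀ < ε / 2 := by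
      rintro ⟨a, u⟩ ⟨ha, -⟩
      rw [dist_eq_norm]
      refine (norm_le_norm_of_abs_le_abs ?_).trans_lt h₀
      have h1 : (a₀ : L) ≤ a := ha
      have h2 : (a : L) ≤ (OrderDual.ofDual u₀).1 := (OrderDual.ofDual u₀).2 a.2
      rw [abs_of_nonneg (sub_nonneg.2 h1), abs_of_nonneg (sub_nonneg.2 (h1.trans h2))]
      exact sub_le_sub_right h2 _
    rintro _ ⟨i, hi, rfl⟩ _ ⟨j, hj, rfl⟩
    have := dist_triangle_right (i.1 : L) j.1 a₀
    linarith [key i hi, key j hj]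
  obtain ⟨s, hs⟩ := CompleteSpace.complete hcau
  have hs' : Tendsto (fun i : S × (upperBounds S)ᵒᵈ => (i.1 : L)) atTop (𝓝 s) := hs
  refine ⟨s, mem_closure_of_tendsto hs' (Eventually.of_forall fun i => i.1.2), ?_, ?_⟩
  · intro a ha
    refine ge_of_tendsto hs' ?_
    filter_upwards [Ici_mem_atTop ((⟨a, ha⟩ : S), Classical.arbitrary (upperBounds S)ᵒᵈ)]
      with i hi
    exact hi.1
  · exact fun u hu => le_of_tendsto hs' (Eventually.of_forall fun i => hu i.1.2)

/-- The component of `x` in `J` is the supremum `s` of `J ∩ [0, x]`. For `z ∈ J` the vector `|x - s|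
⊓ |z|` could be added to `s` within this set, so it vanishes. -/
theorem IsClosedIdeal.exists_mem_sub_mem_disjointCompl (hL : HasOrderContinuousNorm L)
    {J : Submodule ℝ L} (hJ : IsClosedIdeal J) {x : L} (hx : 0 ≤ x) :
    ∃ y ∈ J, 0 ≤ y ∧ y ≤ x ∧ x - y ∈ disjointCompl (J : Set L) := by
  obtain ⟨s, hsc, hs⟩ := exists_isLUB_mem_closure hL (S := {y : L | y ∈ J ∧ 0 ≤ y ∧ y ≤ x})
    ⟨0, J.zero_mem, le_rfl, hx⟩
    (fun a ha b hb => ⟨a ⊔ b,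
      ⟨hJ.1.mem_of_le (ha.2.1.trans le_sup_left)
        (sup_le (le_add_of_nonneg_right hb.2.1) (le_add_of_nonneg_left ha.2.1))
        (J.add_mem ha.1 hb.1), ha.2.1.trans le_sup_left, sup_le ha.2.2 hb.2.2⟩,
      le_sup_left, le_sup_right⟩)
    ⟨x, fun y hy => hy.2.2⟩
  have hsJ : s ∈ J := by
    exact closure_minimal (fun y hy => hy.1) hJ.2 hsc
  have hs0 : 0 ≤ s := hs.1 ⟨J.zero_mem, le_rfl, hx⟩
  have hsx : s ≤ x := hs.2 fun y hy => hy.2.2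
  refine ⟨s, hsJ, hs0, hsx, fun z hz => ?_⟩
  have hw0 : 0 ≤ |x - s| ⊓ |z| := le_inf (abs_nonneg _) (abs_nonneg _)
  refine le_antisymm ?_ hw0
  have hwJ : |x - s| ⊓ |z| ∈ J := hJ.1.mem_of_le hw0 inf_le_right (hJ.1.abs_mem hz)
  have h : s + |x - s| ⊓ |z| ≤ s := hs.1 ⟨J.add_mem hsJ hwJ, add_nonneg hs0 hw0, by
    rw [← le_sub_iff_add_le', abs_of_nonneg (sub_nonneg.2 hsx)]
    exact inf_le_left⟩
  exact (add_le_iff_nonpos_right s).1 h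

/-- Every closed ideal `J` of a Banach lattice with order continuous norm is a projection band. -/
theorem IsClosedIdeal.exists_bandProjection (hL : HasOrderContinuousNorm L)
    {J : Submodule ℝ L} (hJ : IsClosedIdeal J) :
    ∃ p : L →L[ℝ] L, IsPositiveOp p ∧ (∀ x, 0 ≤ x → p x ≤ x) ∧ (∀ x, p x ∈ J) ∧
      (∀ x ∈ J, p x = x) ∧ (∀ x ∈ disjointCompl (J : Set L), p x = 0) ∧
      (∀ x, x - p x ∈ disjointCompl (J : Set L)) ∧ ∀ x, |p x| ≤ |x| := by
  have hc : IsCompl J (disjointCompl (J : Set L)) := by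
    constructor
    · rw [Submodule.disjoint_def]
      exact fun x hx hx' => eq_zero_of_mem_disjointCompl hx hx'
    · rw [codisjoint_iff, eq_top_iff]
      intro x _
      have hpos : ∀ y : L, 0 ≤ y → y ∈ J ⊔ disjointCompl (J : Set L) := fun y hy => by
        obtain ⟨z, hz, -, -, hyz⟩ := hJ.exists_mem_sub_mem_disjointCompl hL hy
        exact Submodule.mem_sup.2 ⟨z, hz, _, hyz, add_sub_cancel z y⟩
      rw [← posPart_sub_negPart x]
      exact Submodule.sub_mem _ (hpos _ (posPart_nonneg x)) (hpos _ (negPart_nonneg x))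
  set q := J.projection _ hc with hq
  have hqpos : ∀ x, 0 ≤ x → 0 ≤ q x ∧ q x ≤ x := fun x hx => by
    obtain ⟨y, hy, hy0, hyx, hxy⟩ := hJ.exists_mem_sub_mem_disjointCompl hL hx
    have h : q x = y := by
      rw [← add_sub_cancel y x, map_add,
        Submodule.projection_apply_of_mem_left hc hy,
        (Submodule.projection_apply_eq_zero_iff hc).2 hxy, add_zero]
    rw [h]
    exact ⟨hy0, hyx⟩
  have hmono : ∀ x y, x ≤ y → q x ≤ q y := fun x y hxy => by
    have := (hqpos (y - x) (sub_nonneg.2 hxy)).1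
    rwa [map_sub, sub_nonneg] at this
  have habs : ∀ x, |q x| ≤ |x| := fun x => by
    refine le_trans ?_ (hqpos |x| (abs_nonneg x)).2
    rw [abs_le', ← map_neg]
    exact ⟨hmono _ _ (le_abs_self x), hmono _ _ (neg_le_abs x)⟩
  refine ⟨q.mkContinuous 1 fun x => ?_, fun x hx => (hqpos x hx).1, fun x hx => (hqpos x hx).2,
    fun x => Submodule.projection_apply_mem hc x,
    fun x hx => Submodule.projection_apply_of_mem_left hc hx,
    fun x hx => (Submodule.projection_apply_eq_zero_iff hc).2 hx,
    fun x => Submodule.sub_projection_mem hc x, habs⟩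
  rw [one_mul]
  exact norm_le_norm_of_abs_le_abs (habs x)

end OrderContinuousNorm

/-! ### Disjoint bases of finite-dimensional sublattices. -/

section FiniteDimensionalSublattice

variable {L : Type u} [NormedAddCommGroup L] [Lattice L] [HasSolidNorm L]
  [IsOrderedAddMonoid L] [NormedSpace ℝ L] [IsOrderedModule ℝ L]

/-- A family of pairwise disjoint nonzero positive elements of `V`. -/
structure IsDisjointFamily {ι : Type*} (V : Submodule ℝ L) (e : ι → L) : Prop where
  mem : ∀ i, e i ∈ V
  nonneg : ∀ i, 0 ≤ e i
  ne_zero : ∀ i, e i ≠ 0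
  disjoint : ∀ i j, i ≠ j → |e i| ⊓ |e j| = 0

theorem IsDisjointFamily.cons {V : Submodule ℝ L} {k : ℕ} {e : Fin k → L}
    (he : IsDisjointFamily V e) {a : L} (haV : a ∈ V) (ha : 0 ≤ a) (ha0 : a ≠ 0)
    (had : ∀ i, |a| ⊓ |e i| = 0) : IsDisjointFamily V (Fin.cons a e : Fin (k + 1) → L) where
  mem i := by cases i using Fin.cases <;> simp [haV, he.mem]
  nonneg i := by cases i using Fin.cases <;> simp [ha, he.nonneg]
  ne_zero i := by cases i using Fin.cases <;> simp [ha0, he.ne_zero]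
  disjoint i j hij := by
    cases i using Fin.cases with
    | zero => cases j using Fin.cases with
      | zero => exact absurd rfl hij
      | succ j => simpa using had j
    | succ i => cases j using Fin.cases with
      | zero => simpa [inf_comm] using had i
      | succ j => simpa using he.disjoint i j fun h => hij (by rw [h])

theorem IsDisjointFamily.update {V : Submodule ℝ L} {ι : Type*} [DecidableEq ι] {e : ι → L}
    (he : IsDisjointFamily V e) (i : ι) {b : L} (hbV : b ∈ V) (hb : 0 ≤ b) (hb0 : b ≠ 0)
    (hbd : ∀ j, j ≠ i → |b| ⊓ |e j| = 0) : IsDisjointFamily V (Function.update e i b) where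
  mem j := by
    rcases eq_or_ne j i with rfl | h
    · simpa using hbV
    · simpa [h] using he.mem j
  nonneg j := by
    rcases eq_or_ne j i with rfl | h
    · simpa using hb
    · simpa [h] using he.nonneg j
  ne_zero j := by
    rcases eq_or_ne j i with rfl | h
    · simpa using hb0
    · simpa [h] using he.ne_zero j
  disjoint j l hjl := by
    rcases eq_or_ne j i with rfl | h
    · simpa [hjl.symm] using hbd l hjl.symm
    · rcases eq_or_ne l i with rfl | h'
      · simpa [h, inf_comm] using hbd j h
      · simpa [h, h'] using he.disjoint j l hjl

theorem IsDisjointFamily.card_le {V : Submodule ℝ L} [FiniteDimensional ℝ V] {k : ℕ}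
    {e : Fin k → L} (he : IsDisjointFamily V e) : k ≤ Module.finrank ℝ V := by
  have h := linearIndependent_of_pairwise_disjoint he.ne_zero he.disjoint
  have h' : LinearIndependent ℝ fun i => (⟨e i, he.mem i⟩ : V) :=
    LinearIndependent.of_comp V.subtype h
  simpa using h'.fintype_card_le_finrank

theorem abs_posPart_inf_abs_negPart (x : L) : |x⁺| ⊓ |x⁻| = 0 := by
  rw [abs_of_nonneg (posPart_nonneg x), abs_of_nonneg (negPart_nonneg x),
    posPart_inf_negPart_eq_zero]

theorem abs_posPart_le (x : L) : |x⁺| ≤ |x| := by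
  rw [abs_of_nonneg (posPart_nonneg x), ← posPart_add_negPart]
  exact le_add_of_nonneg_right (negPart_nonneg x)

theorem abs_negPart_le (x : L) : |x⁻| ≤ |x| := by
  rw [abs_of_nonneg (negPart_nonneg x), ← posPart_add_negPart]
  exact le_add_of_nonneg_left (posPart_nonneg x)

theorem posPart_mem_of_abs_mem {V : Submodule ℝ L} (hV : ∀ x ∈ V, |x| ∈ V) {x : L}
    (hx : x ∈ V) : x⁺ ∈ V := by
  have h : x⁺ = (2⁻¹ : ℝ) • (|x| + x) := by
    have h1 := posPart_add_negPart x
    have h2 := posPart_sub_negPart x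
    rw [← h1, eq_inv_smul_iff₀ two_ne_zero, two_smul]
    nth_rewrite 5 [← h2]
    abel
  rw [h]
  exact V.smul_mem _ (V.add_mem (hV x hx) hx)

theorem negPart_mem_of_abs_mem {V : Submodule ℝ L} (hV : ∀ x ∈ V, |x| ∈ V) {x : L}
    (hx : x ∈ V) : x⁻ ∈ V := by
  rw [← posPart_neg]
  exact posPart_mem_of_abs_mem hV (V.neg_mem hx)

theorem inf_mem_of_abs_mem {V : Submodule ℝ L} (hV : ∀ x ∈ V, |x| ∈ V) {x y : L}
    (hx : x ∈ V) (hy : y ∈ V) : x ⊓ y ∈ V := by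
  rw [inf_eq_sub_posPart_sub]
  exact V.sub_mem hx (posPart_mem_of_abs_mem hV (V.sub_mem hx hy))

theorem posPart_eq_zero_or_negPart_eq_zero_iff {x y : L} :
    (x - y)⁺ = 0 ∨ (x - y)⁻ = 0 ↔ y ≤ x ∨ x ≤ y := by
  rw [posPart_eq_zero, negPart_eq_zero, sub_nonpos, sub_nonneg, or_comm]

/-- A finite-dimensional vector sublattice of a normed Riesz space is spanned by pairwise disjoint
positive elements. -/
theorem exists_isDisjointFamily_span_eq {V : Submodule ℝ L} (hV : ∀ x ∈ V, |x| ∈ V)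
    [FiniteDimensional ℝ V] :
    ∃ e : Fin (Module.finrank ℝ V) → L, IsDisjointFamily V e ∧
      Submodule.span ℝ (Set.range e) = V := by
  classical
  suffices h : ∃ k, ∃ e : Fin k → L, IsDisjointFamily V e ∧ Submodule.span ℝ (Set.range e) = V by
    obtain ⟨k, e, he, hspan⟩ := h
    have hk : Module.finrank ℝ V = k := by
      rw [← hspan, finrank_span_eq_card
        (linearIndependent_of_pairwise_disjoint he.ne_zero he.disjoint), Fintype.card_fin]
    rw [hk]
    exact ⟨e, he, hspan⟩
  -- A disjoint family of largest size exists because disjoint nonzero vectors are linearly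
  -- independent.
  obtain ⟨k, ⟨e, he⟩, hmax⟩ : ∃ k, (∃ e : Fin k → L, IsDisjointFamily V e) ∧
      ¬ ∃ e : Fin (k + 1) → L, IsDisjointFamily V e := by
    by_contra! hcon
    have hall : ∀ k, ∃ e : Fin k → L, IsDisjointFamily V e := fun k => by
      induction k with
      | zero => exact ⟨Fin.elim0, fun i => i.elim0, fun i => i.elim0, fun i => i.elim0,
          fun i => i.elim0⟩
      | succ k ih => exact hcon k ih
    obtain ⟨e, he⟩ := hall (Module.finrank ℝ V + 1)
    exact absurd he.card_le (by omega)
  have hzero : ∀ x ∈ V, 0 ≤ x → (∀ i, |x| ⊓ |e i| = 0) → x = 0 := fun x hxV hx hd => by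
    by_contra hx0
    exact hmax ⟨_, he.cons hxV hx hx0 hd⟩
  -- Were `x` and `t • e i` incomparable, the positive and negative parts of their difference could
  -- replace `e i`, giving a larger disjoint family.
  have hatom : ∀ i, ∀ x ∈ V, (∀ j, j ≠ i → |x| ⊓ |e j| = 0) → ∃ t : ℝ, t • e i = x := by
    intro i x hxV hd
    refine exists_smul_eq_of_forall_le_or_le (he.nonneg i) (he.ne_zero i) fun t => ?_
    rw [← posPart_eq_zero_or_negPart_eq_zero_iff]
    by_contra! hcon
    have hyV : x - t • e i ∈ V := V.sub_mem hxV (V.smul_mem _ (he.mem i))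
    have hyd : ∀ j, j ≠ i → |x - t • e i| ⊓ |e j| = 0 := fun j hj =>
      mem_disjointCompl_singleton.1 (Submodule.sub_mem _ (mem_disjointCompl_singleton.2 (hd j hj))
        (Submodule.smul_mem _ _ (mem_disjointCompl_singleton.2 (he.disjoint i j hj.symm))))
    have hup := he.update i (negPart_mem_of_abs_mem hV hyV) (negPart_nonneg _) hcon.2
      fun j hj => inf_abs_eq_zero_of_le (abs_negPart_le _) (hyd j hj)
    refine hmax ⟨_, hup.cons (posPart_mem_of_abs_mem hV hyV) (posPart_nonneg _) hcon.1
      fun j => ?_⟩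
    rcases eq_or_ne j i with rfl | hj
    · simpa using abs_posPart_inf_abs_negPart _
    · simpa [hj] using inf_abs_eq_zero_of_le (abs_posPart_le _) (hyd j hj)
  -- The `e i`-component of `x` is the truncation `x ⊓ m • e i`. It equals `c • e i` with `c ≤ ‖x‖ /
  -- ‖e i‖`, so the extra `1` in `m` leaves room to add `(x - c • e i) ⊓ e i` below the truncation,
  -- which forces that infimum to vanish.
  have hcomp : ∀ i, ∀ x ∈ V, 0 ≤ x → ∃ c : ℝ, 0 ≤ c ∧ c • e i ≤ x ∧ |x - c • e i| ⊓ |e i| = 0 := by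
    intro i x hxV hx
    have hn : 0 < ‖e i‖ := norm_pos_iff.2 (he.ne_zero i)
    have hm0 : (0 : ℝ) ≤ ‖x‖ / ‖e i‖ + 1 := by positivity
    set m : ℝ := ‖x‖ / ‖e i‖ + 1 with hm
    have hme : 0 ≤ m • e i := smul_nonneg hm0 (he.nonneg i)
    have hinf0 : 0 ≤ x ⊓ m • e i := le_inf hx hme
    obtain ⟨c, hc⟩ := hatom i (x ⊓ m • e i)
      (inf_mem_of_abs_mem hV hxV (V.smul_mem _ (he.mem i))) fun j hj => by
        refine inf_abs_eq_zero_of_le (y := m • e i) ?_ (mem_disjointCompl_singleton.1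
          (Submodule.smul_mem _ _ (mem_disjointCompl_singleton.2 (he.disjoint i j hj.symm))))
        rw [abs_of_nonneg hinf0, abs_of_nonneg hme]
        exact inf_le_right
    have hc0 : 0 ≤ c := by
      by_contra! hneg
      have h1 : 0 ≤ c • e i := hc ▸ hinf0
      have h2 : (-c) • e i ≤ 0 := by rwa [neg_smul, neg_nonpos]
      have h3 : (-c) • e i = 0 := le_antisymm h2 (smul_nonneg (by linarith) (he.nonneg i))
      rcases smul_eq_zero.1 h3 with h | h
      · linarith
      · exact he.ne_zero i h
    have hcx : c • e i ≤ x := hc ▸ inf_le_left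
    have hcm : c + 1 ≤ m := by
      have h1 : ‖c • e i‖ ≤ ‖x‖ := norm_le_norm_of_abs_le_abs (by
        rwa [abs_of_nonneg hx, abs_of_nonneg (smul_nonneg hc0 (he.nonneg i))])
      rw [norm_smul, Real.norm_of_nonneg hc0, ← le_div_iff₀ hn] at h1
      linarith
    refine ⟨c, hc0, hcx, ?_⟩
    rw [abs_of_nonneg (sub_nonneg.2 hcx), abs_of_nonneg (he.nonneg i)]
    refine le_antisymm ?_ (le_inf (sub_nonneg.2 hcx) (he.nonneg i))
    have h : c • e i + (x - c • e i) ⊓ e i ≤ c • e i := by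
      conv_rhs => rw [hc]
      refine le_inf ?_ ?_
      · rw [← le_sub_iff_add_le']
        exact inf_le_left
      · rw [← le_sub_iff_add_le', ← sub_smul]
        exact inf_le_right.trans (le_smul_of_one_le_left (he.nonneg i) (by linarith))
    exact (add_le_iff_nonpos_right _).1 h
  have hmem : ∀ i, e i ∈ Submodule.span ℝ (Set.range e) := fun i =>
    Submodule.subset_span ⟨i, rfl⟩
  have hle : Submodule.span ℝ (Set.range e) ≤ V :=
    Submodule.span_le.2 (Set.range_subset_iff.2 he.mem)
  have hpos : ∀ x ∈ V, 0 ≤ x → x ∈ Submodule.span ℝ (Set.range e) := by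
    intro x hxV hx
    have hs : ∀ s : Finset (Fin k), ∃ w ∈ Submodule.span ℝ (Set.range e), 0 ≤ x - w ∧
        ∀ i ∈ s, |x - w| ⊓ |e i| = 0 := by
      intro s
      induction s using Finset.induction_on with
      | empty => exact ⟨0, Submodule.zero_mem _, by simpa using hx, by simp⟩
      | insert j s _ ih =>
        obtain ⟨w, hw, hw0, hws⟩ := ih
        obtain ⟨c, hc, hcw, hcd⟩ := hcomp j (x - w) (V.sub_mem hxV (hle hw)) hw0
        refine ⟨w + c • e j, Submodule.add_mem _ hw (Submodule.smul_mem _ _ (hmem j)), ?_, ?_⟩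
        · rw [← sub_sub]
          exact sub_nonneg.2 hcw
        · intro i hi
          rw [← sub_sub]
          rcases Finset.mem_insert.1 hi with rfl | hi
          · exact hcd
          · refine inf_abs_eq_zero_of_le ?_ (hws i hi)
            rw [abs_of_nonneg (sub_nonneg.2 hcw), abs_of_nonneg hw0]
            exact sub_le_self _ (smul_nonneg hc (he.nonneg j))
    obtain ⟨w, hw, hw0, hwd⟩ := hs Finset.univ
    have h0 := hzero (x - w) (V.sub_mem hxV (hle hw)) hw0 fun i => hwd i (Finset.mem_univ i)
    rw [sub_eq_zero.1 h0]
    exact hw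
  refine ⟨k, e, he, le_antisymm hle fun x hx => ?_⟩
  rw [← posPart_sub_negPart x]
  exact Submodule.sub_mem _ (hpos _ (posPart_mem_of_abs_mem hV hx) (posPart_nonneg x))
    (hpos _ (negPart_mem_of_abs_mem hV hx) (negPart_nonneg x))

end FiniteDimensionalSublattice

/-! ### Maximal chains of closed ideals, and strictly positive finite-rank projections. -/

section PositiveProjections

variable {L : Type u} [NormedAddCommGroup L] [Lattice L] [HasSolidNorm L]
  [IsOrderedAddMonoid L] [NormedSpace ℝ L] [IsOrderedModule ℝ L]

theorem isBandDecomposition_of_isClosedIdeal (hL : HasOrderContinuousNorm L) {ι : Type*}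
    {B : ι → Submodule ℝ L} {M : Submodule ℝ L} (hB : ∀ i, IsClosedIdeal (B i))
    (hd : ∀ i j, i ≠ j → B i ≤ disjointCompl (B j : Set L)) (hM : ⨆ i, B i = M) :
    IsBandDecomposition B M :=
  have h : ∀ i j, i ≠ j → ∀ x ∈ B i, ∀ y ∈ B j, |x| ⊓ |y| = 0 :=
    fun i j hij _ hx y hy => hd i j hij hx y hy
  ⟨fun i => (hB i).isBand hL, h, iSupIndep_of_pairwise_disjoint h, hM⟩

/-- If the members of a maximal chain of closed ideals meet the closed ideal generated by `e ≥ 0`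
trivially or contain `e`, then this closed ideal is one-dimensional. -/
theorem closedIdealSpan_le_span_of_maximal_chain {C : Set (Submodule ℝ L)}
    (hC : Maximal (fun D : Set (Submodule ℝ L) =>
      IsChain (· ≤ ·) D ∧ ∀ J ∈ D, IsClosedIdeal J) C) {e : L} (he : 0 ≤ e)
    (h : ∀ J ∈ C, ∀ u ∈ closedIdealSpan {e}, u ∈ J → u ≠ 0 → e ∈ J) :
    closedIdealSpan {e} ≤ Submodule.span ℝ {e} := by
  rcases eq_or_ne e 0 with rfl | he0
  · refine (closedIdealSpan_le bot_isClosedIdeal ?_).trans bot_le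
    simp
  have hM := closedIdealSpan_isClosedIdeal ({e} : Set L)
  have key : ∀ u ∈ closedIdealSpan {e}, ∀ v ∈ closedIdealSpan {e}, |u| ⊓ |v| = 0 → u ≠ 0 →
      v = 0 := by
    intro u hu v hv huv hu0
    -- The closed ideal generated by `u` and all chain members omitting `e` is comparable with the
    -- whole chain, so it belongs to it by maximality. It contains `u`, hence `e`. Yet its
    -- generators are disjoint from `v`, since members omitting `e` meet the ideal of `e` trivially.
    -- So `v` is disjoint from `e`, and therefore from itself.
    set S : Set L := {u} ∪ ⋃ J ∈ {J | J ∈ C ∧ e ∉ J}, (J : Set L) with hS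
    have hJ := closedIdealSpan_isClosedIdeal S
    have huJ : u ∈ closedIdealSpan S := subset_closedIdealSpan _ (Or.inl rfl)
    have hmemC : closedIdealSpan S ∈ C := by
      have hins : IsChain (· ≤ ·) (insert (closedIdealSpan S) C) ∧
          ∀ J ∈ insert (closedIdealSpan S) C, IsClosedIdeal J := by
        refine ⟨hC.prop.1.insert fun J hJC _ => ?_, ?_⟩
        · by_cases heJ : e ∈ J
          · left
            have hMJ : closedIdealSpan {e} ≤ J :=
              closedIdealSpan_le (hC.prop.2 J hJC) (Set.singleton_subset_iff.2 heJ)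
            refine closedIdealSpan_le (hC.prop.2 J hJC) (Set.union_subset
              (Set.singleton_subset_iff.2 (hMJ hu)) (Set.iUnion₂_subset fun K hK => ?_))
            rcases hC.prop.1.total hJC hK.1 with hle | hle
            · exact absurd (hle heJ) hK.2
            · exact hle
          · right
            intro x hx
            exact subset_closedIdealSpan _ (Or.inr (Set.mem_biUnion ⟨hJC, heJ⟩ hx))
        · rintro J (rfl | hJC)
          · exact hJ
          · exact hC.prop.2 J hJC
      exact hC.le_of_ge hins (Set.subset_insert _ _) (Set.mem_insert _ _)
    have hSv : closedIdealSpan S ≤ disjointCompl {v} := by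
      refine closedIdealSpan_le (disjointCompl_isClosedIdeal _) (Set.union_subset
        (Set.singleton_subset_iff.2 (mem_disjointCompl_singleton.2 huv))
        (Set.iUnion₂_subset fun K hK x hx => mem_disjointCompl_singleton.2 ?_))
      by_contra hne
      have h0 : 0 ≤ |x| ⊓ |v| := le_inf (abs_nonneg _) (abs_nonneg _)
      exact hK.2 (h K hK.1 _ (hM.1.mem_of_le h0 inf_le_right (hM.1.abs_mem hv))
        ((hC.prop.2 K hK.1).1.mem_of_le h0 inf_le_left
          ((hC.prop.2 K hK.1).1.abs_mem hx)) hne)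
    have heJ := hSv (h _ hmemC u hu huJ hu0)
    have hMv := closedIdealSpan_le (disjointCompl_isClosedIdeal {v})
      (Set.singleton_subset_iff.2 heJ)
    exact eq_zero_of_abs_inf_self (mem_disjointCompl_singleton.1 (hMv hv))
  intro x hx
  rw [Submodule.mem_span_singleton]
  refine exists_smul_eq_of_forall_le_or_le he he0 fun t => ?_
  rw [← posPart_eq_zero_or_negPart_eq_zero_iff, or_iff_not_imp_left]
  have hy : x - t • e ∈ closedIdealSpan {e} :=
    Submodule.sub_mem _ hx (Submodule.smul_mem _ _ (mem_closedIdealSpan_singleton e))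
  exact key _ (hM.1 _ _ (abs_posPart_le _) hy) _ (hM.1 _ _ (abs_negPart_le _) hy)
    (abs_posPart_inf_abs_negPart _)

variable [CompleteSpace L]

/-- The structure of a positive finite-rank projection `T` which is strictly positive on the closed
ideal `B` containing its range, when nothing in `B` is disjoint from this range. -/
theorem exists_disjoint_fixed_basis (hL : HasOrderContinuousNorm L) {B : Submodule ℝ L}
    (hB : IsClosedIdeal B) {T : L →L[ℝ] L} (hT : IsPositiveOp T) (hTT : ∀ x, T (T x) = T x)
    (hTB : ∀ x, T x ∈ B) (hstrict : ∀ x ∈ B, 0 ≤ x → T x = 0 → x = 0)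
    (hfull : ∀ y ∈ B, (∀ z, |y| ⊓ |T z| = 0) → y = 0) {r : ℕ}
    (hr : (T : L →ₗ[ℝ] L).rank = r) :
    ∃ e : Fin r → L, (∀ j, 0 ≤ e j ∧ e j ≠ 0 ∧ e j ∈ B ∧ T (e j) = e j) ∧
      (∀ x, T x ∈ Submodule.span ℝ (Set.range e)) ∧
      (∀ j, ∀ x ∈ closedIdealSpan {e j}, T x ∈ closedIdealSpan {e j}) ∧
      (∀ j, ∀ x ∈ closedIdealSpan {e j}, T x ∈ Submodule.span ℝ {e j}) ∧
      IsBandDecomposition (fun j => closedIdealSpan {e j}) B := by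
  set V : Submodule ℝ L := LinearMap.range (T : L →ₗ[ℝ] L) with hVdef
  have hrank : Module.rank ℝ V = r := hr
  have hfin : FiniteDimensional ℝ V :=
    Module.rank_lt_aleph0_iff.1 (hrank ▸ Cardinal.natCast_lt_aleph0)
  have hVT : ∀ x ∈ V, T x = x := by
    rintro _ ⟨y, rfl⟩
    exact hTT y
  have hTV : ∀ x, T x ∈ V := fun x => ⟨x, rfl⟩
  have hVB : ∀ x ∈ V, x ∈ B := fun x hx => hVT x hx ▸ hTB x
  have hVabs : ∀ x ∈ V, |x| ∈ V := by
    intro x hx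
    have hle : |x| ≤ T |x| := by
      have := hT.abs_le x
      rwa [hVT x hx] at this
    have h0 := hstrict (T |x| - |x|) (B.sub_mem (hTB _) (hB.1.abs_mem (hVB x hx)))
      (sub_nonneg.2 hle) (by rw [map_sub, hTT, sub_self])
    rw [← sub_eq_zero.1 h0]
    exact hTV _
  obtain ⟨e, he, hspan⟩ := exists_isDisjointFamily_span_eq hVabs
  have hfr : Module.finrank ℝ V = r := Module.finrank_eq_of_rank_eq hrank
  clear_value V
  subst hfr
  have hdisj : ∀ i j, i ≠ j →
      closedIdealSpan {e i} ≤ disjointCompl (closedIdealSpan {e j} : Set L) :=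
    fun i j hij => closedIdealSpan_singleton_le_disjointCompl (he.disjoint i j hij)
  have hinv : ∀ j, ∀ x ∈ closedIdealSpan {e j}, T x ∈ closedIdealSpan {e j} := by
    intro j x hx
    have hM := closedIdealSpan_isClosedIdeal ({e j} : Set L)
    have hle : closedIdealSpan {e j} ≤ absComap T hT _ hM := by
      refine closedIdealSpan_le (absComap_isClosedIdeal T hT _ hM)
        (Set.singleton_subset_iff.2 (mem_absComap.2 ?_))
      rw [abs_of_nonneg (he.nonneg j), hVT _ (he.mem j)]
      exact mem_closedIdealSpan_singleton _
    refine hM.1 _ _ ?_ (mem_absComap.1 (hle hx))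
    exact (hT.abs_le x).trans (le_abs_self _)
  choose p hp using fun j =>
    (closedIdealSpan_isClosedIdeal ({e j} : Set L)).exists_bandProjection hL
  refine ⟨e, fun j => ⟨he.nonneg j, he.ne_zero j, hVB _ (he.mem j), hVT _ (he.mem j)⟩,
    fun x => hspan.ge (hTV x), hinv, fun j x hx => ?_,
    isBandDecomposition_of_isClosedIdeal hL (fun j => closedIdealSpan_isClosedIdeal _) hdisj ?_⟩
  · obtain ⟨-, -, -, hp1, hp2, -, -⟩ := hp j
    rw [← hp1 _ (hinv j x hx)]
    -- The band projection onto the ideal of `e j` fixes `e j` and kills the other basis vectors, so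
    -- it maps the range of `T` into the line of `e j`.
    have hle : Submodule.span ℝ (Set.range e) ≤
        (Submodule.span ℝ {e j}).comap (p j : L →ₗ[ℝ] L) := by
      refine Submodule.span_le.2 (Set.range_subset_iff.2 fun i => ?_)
      change p j (e i) ∈ Submodule.span ℝ {e j}
      rcases eq_or_ne i j with rfl | hij
      · rw [hp1 _ (mem_closedIdealSpan_singleton _)]
        exact Submodule.mem_span_singleton_self _
      · rw [hp2 _ (hdisj i j hij (mem_closedIdealSpan_singleton _))]
        exact Submodule.zero_mem _
    exact hle (hspan.ge (hTV x))
  · refine le_antisymm (iSup_le fun j => closedIdealSpan_le hB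
      (Set.singleton_subset_iff.2 (hVB _ (he.mem j)))) fun x hx => ?_
    have hsum : ∑ j, p j x ∈ ⨆ j, closedIdealSpan {e j} :=
      Submodule.sum_mem _ fun j _ => Submodule.mem_iSup_of_mem j ((hp j).2.2.1 x)
    -- The remainder is disjoint from every `e j`, hence from the range of `T`, so `hfull` applies.
    have hy : x - ∑ j, p j x = 0 := by
      refine hfull _ (B.sub_mem hx (Submodule.sum_mem _ fun j _ =>
        hB.1 _ _ ((hp j).2.2.2.2.2.2 x) hx)) ?_
      have hperp : ∀ j, x - ∑ i, p i x ∈ disjointCompl (closedIdealSpan {e j} : Set L) := by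
        intro j
        rw [← Finset.add_sum_erase _ _ (Finset.mem_univ j), ← sub_sub]
        refine Submodule.sub_mem _ ((hp j).2.2.2.2.2.1 x) (Submodule.sum_mem _ fun i hi => ?_)
        exact hdisj i j (Finset.ne_of_mem_erase hi) ((hp i).2.2.1 x)
      have hle : Submodule.span ℝ (Set.range e) ≤ disjointCompl {x - ∑ i, p i x} := by
        refine Submodule.span_le.2 (Set.range_subset_iff.2 fun j =>
          mem_disjointCompl_singleton.2 ?_)
        rw [inf_comm]
        exact hperp j _ (mem_closedIdealSpan_singleton _)
      intro z
      rw [inf_comm]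
      exact mem_disjointCompl_singleton.1 (hle (hspan.ge (hTV z)))
    rw [sub_eq_zero.1 hy]
    exact hsum

end PositiveProjections

end RieszOp

/-! ### The block form of a positive finite-rank projection. -/

theorem proposition2p3 {L : Type*} [NormedAddCommGroup L] [Lattice L] [HasSolidNorm L]
    [IsOrderedAddMonoid L] [NormedSpace ℝ L] [IsOrderedModule ℝ L] [CompleteSpace L]
    (hL : HasOrderContinuousNorm L)
    (P : L →L[ℝ] L) (hPpos : IsPositiveOp P) (hPidem : IsIdempotentElem P)
    (r : ℕ) (hPrank : (P : L →ₗ[ℝ] L).rank = r) :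
    ∃ (B₁ B₂ B₃ : Submodule ℝ L) (X : B₂ →L[ℝ] B₁) (Q : B₂ →L[ℝ] B₂) (Y : B₃ →L[ℝ] B₂),
      IsBandDecomposition ![B₁, B₂, B₃] ⊤ ∧
      IsPositiveOp X ∧ IsPositiveOp Y ∧
      -- the block matrix of `P`
      (∀ (b₁ : B₁) (b₂ : B₂) (b₃ : B₃), P (b₁ + b₂ + b₃) =
        ((X (Q b₂) + X (Q (Y b₃)) : B₁) : L) + ((Q b₂ + Q (Y b₃) : B₂) : L)) ∧
      -- its factorization as column times `Q` times row
      (∀ (b₁ : B₁) (b₂ : B₂) (b₃ : B₃), P (b₁ + b₂ + b₃) =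
        (X (Q (b₂ + Y b₃)) : L) + (Q (b₂ + Y b₃) : L)) ∧
      IsIdempotentElem Q ∧ (Q : B₂ →ₗ[ℝ] B₂).rank = r ∧
      IsStrictlyPositiveOp Q ∧ IsStrictlyPositiveDualOp (adjointOp Q) ∧
      (∃ (M : Fin r → Submodule ℝ L) (hM : ∀ j, M j ≤ B₂) (R : ∀ j, M j →L[ℝ] M j),
        IsBandDecomposition M B₂ ∧
        (∀ j, ∀ x : M j, (Q (Submodule.inclusion (hM j) x) : L) = R j x) ∧
        ∀ j, IsIdempotentElem (R j) ∧ (R j : M j →ₗ[ℝ] M j).rank = 1 ∧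
          IsStrictlyPositiveOp (R j)) ∧
      (IsIdealTriangularizable {P} →
        FiniteDimensional ℝ B₂ ∧ Q = ContinuousLinearMap.id ℝ B₂) := by
  have hPP : ∀ x, P (P x) = P x := fun x => DFunLike.congr_fun hPidem x
  set N : Submodule ℝ L := absComap P hPpos ⊥ bot_isClosedIdeal with hNdef
  have hN : IsClosedIdeal N := absComap_isClosedIdeal _ _ _ _
  set R : Submodule ℝ L := closedIdealSpan (Set.range P) with hRdef
  have hR : IsClosedIdeal R := closedIdealSpan_isClosedIdeal _
  have hPR : ∀ x, P x ∈ R := fun x => subset_closedIdealSpan _ ⟨x, rfl⟩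
  set B₂ : Submodule ℝ L := disjointCompl (N : Set L) ⊓ R with hB₂def
  set B₃ : Submodule ℝ L := disjointCompl (N : Set L) ⊓ disjointCompl (R : Set L) with hB₃def
  have hB₂ : IsClosedIdeal B₂ := (disjointCompl_isClosedIdeal _).inf hR
  have hB₃ : IsClosedIdeal B₃ := (disjointCompl_isClosedIdeal _).inf (disjointCompl_isClosedIdeal _)
  have h21 : B₂ ≤ disjointCompl (N : Set L) := inf_le_left
  have h31 : B₃ ≤ disjointCompl (N : Set L) := inf_le_left
  have h32 : B₃ ≤ disjointCompl (B₂ : Set L) := fun x hx y hy => hx.2 y hy.2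
  have h12 := le_disjointCompl_symm h21
  have h13 := le_disjointCompl_symm h31
  have h23 := le_disjointCompl_symm h32
  obtain ⟨p₁, hp₁, -, hp₁mem, hp₁id, hp₁zero, hp₁sub, -⟩ := hN.exists_bandProjection hL
  obtain ⟨p₂, hp₂, -, hp₂mem, hp₂id, hp₂zero, -, hp₂abs⟩ := hB₂.exists_bandProjection hL
  obtain ⟨q, -, -, hqmem, -, -, hqsub, hqabs⟩ := hR.exists_bandProjection hL
  have hdecomp : ∀ x : L, ∃ b₁ ∈ N, ∃ b₂ ∈ B₂, ∃ b₃ ∈ B₃, x = b₁ + b₂ + b₃ := by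
    intro x
    have hd := (disjointCompl_isClosedIdeal (N : Set L)).1 _ _ (hqabs (x - p₁ x)) (hp₁sub x)
    exact ⟨p₁ x, hp₁mem x, q (x - p₁ x), ⟨hd, hqmem _⟩, x - p₁ x - q (x - p₁ x),
      ⟨Submodule.sub_mem _ (hp₁sub x) hd, hqsub _⟩, by abel⟩
  have hPN : ∀ x ∈ N, P x = 0 := by
    intro x hx
    have h : P |x| = 0 := (Submodule.mem_bot ℝ).1 hx
    have h' := hPpos.abs_le x
    rw [h] at h'
    exact eq_zero_of_abs_eq_zero (le_antisymm h' (abs_nonneg _))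
  -- An element of `R` has no `B₃`-component: that component is disjoint from the element and from
  -- its other two components, hence from itself.
  have hRsum : ∀ x ∈ R, p₁ x + p₂ x = x := by
    intro x hx
    obtain ⟨b₁, h₁, b₂, h₂, b₃, h₃, rfl⟩ := hdecomp x
    have hz : b₃ = 0 := by
      have h4 : b₁ + b₂ + b₃ - b₁ ∈ disjointCompl (N : Set L) := by
        have : b₁ + b₂ + b₃ - b₁ = b₂ + b₃ := by abel
        rw [this]
        exact Submodule.add_mem _ (h21 h₂) (h31 h₃)
      have h5 : |b₁ + b₂ + b₃| ⊓ |b₃| = 0 := by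
        rw [inf_comm]
        exact h₃.2 _ hx
      have h6 : b₃ ∈ disjointCompl {b₃} := by
        have h7 := Submodule.sub_mem _ (Submodule.sub_mem _ (mem_disjointCompl_singleton.2 h5)
          (mem_disjointCompl_singleton.2 (h13 h₁ b₃ h₃)))
          (mem_disjointCompl_singleton.2 (h23 h₂ b₃ h₃))
        have : b₁ + b₂ + b₃ - b₁ - b₂ = b₃ := by abel
        rwa [this] at h7
      exact eq_zero_of_abs_inf_self (mem_disjointCompl_singleton.1 h6)
    rw [hz, add_zero, map_add, map_add, hp₁id _ h₁, hp₁zero _ (h21 h₂), hp₂id _ h₂,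
      hp₂zero _ (h12 h₁), add_zero, zero_add]
  set A : L →L[ℝ] L := p₁.comp P with hAdef
  set D : L →L[ℝ] L := p₂.comp P with hDdef
  have hA : IsPositiveOp A := fun x hx => hp₁ _ (hPpos x hx)
  have hD : IsPositiveOp D := fun x hx => hp₂ _ (hPpos x hx)
  have hAmem : ∀ x, A x ∈ N := fun x => hp₁mem _
  have hDmem : ∀ x, D x ∈ B₂ := fun x => hp₂mem _
  have hPAD : ∀ x, P x = A x + D x := fun x => (hRsum _ (hPR x)).symm
  have hPD : ∀ x, P (D x) = P x := by
    intro x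
    conv_rhs => rw [← hPP x, hPAD x, map_add, hPN _ (hAmem x), zero_add]
  have hAD : ∀ x, A (D x) = A x := fun x => congrArg p₁ (hPD x)
  have hDD : ∀ x, D (D x) = D x := fun x => congrArg p₂ (hPD x)
  have hDstrict : ∀ x ∈ B₂, 0 ≤ x → D x = 0 → x = 0 := by
    intro x hx hx0 hDx
    refine eq_zero_of_mem_disjointCompl (J := N) ?_ (h21 hx)
    refine mem_absComap.2 ?_
    rw [abs_of_nonneg hx0, ← hPD, hDx, map_zero]
    exact Submodule.zero_mem _
  -- Such a `y` is also disjoint from the values of `A`, which lie in `N`; so it is disjoint from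
  -- the range of `P`, and thus from `R`, to which it belongs.
  have hDfull : ∀ y ∈ B₂, (∀ z, |y| ⊓ |D z| = 0) → y = 0 := by
    intro y hy hyD
    have hle : R ≤ disjointCompl {y} := by
      refine closedIdealSpan_le (disjointCompl_isClosedIdeal _) (Set.range_subset_iff.2 fun z => ?_)
      rw [hPAD z]
      refine Submodule.add_mem _ (mem_disjointCompl_singleton.2 (h12 (hAmem z) y hy))
        (mem_disjointCompl_singleton.2 ?_)
      rw [inf_comm]
      exact hyD z
    exact eq_zero_of_abs_inf_self (mem_disjointCompl_singleton.1 (hle hy.2))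
  have hDrank : (D : L →ₗ[ℝ] L).rank = r := by
    rw [← hPrank]
    refine le_antisymm ?_ ?_
    · exact LinearMap.rank_comp_le_right (P : L →ₗ[ℝ] L) (p₂ : L →ₗ[ℝ] L)
    · have h : (P : L →ₗ[ℝ] L) = (P : L →ₗ[ℝ] L).comp (D : L →ₗ[ℝ] L) :=
        LinearMap.ext fun x => (hPD x).symm
      rw [h]
      exact LinearMap.rank_comp_le_right (D : L →ₗ[ℝ] L) (P : L →ₗ[ℝ] L)
  obtain ⟨e, he, hspan, hinv, hone, hband⟩ :=
    exists_disjoint_fixed_basis hL hB₂ hD hDD hDmem hDstrict hDfull hDrank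
  set X : B₂ →L[ℝ] N := (A.comp B₂.subtypeL).codRestrict N fun x => hAmem x with hXdef
  set Q : B₂ →L[ℝ] B₂ := (D.comp B₂.subtypeL).codRestrict B₂ fun x => hDmem x with hQdef
  set Y : B₃ →L[ℝ] B₂ := (D.comp B₃.subtypeL).codRestrict B₂ fun x => hDmem x with hYdef
  have hX' : ∀ x : B₂, (X x : L) = A x := fun _ => rfl
  have hQ' : ∀ x : B₂, (Q x : L) = D x := fun _ => rfl
  have hY' : ∀ x : B₃, (Y x : L) = D x := fun _ => rfl
  have hfact : ∀ (b₁ : N) (b₂ : B₂) (b₃ : B₃), P (b₁ + b₂ + b₃) =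
      (X (Q (b₂ + Y b₃)) : L) + (Q (b₂ + Y b₃) : L) := by
    intro b₁ b₂ b₃
    rw [hX', hQ', Submodule.coe_add, hY', hAD, ← hPAD, map_add, map_add, map_add, hPN _ b₁.2,
      zero_add, hPD]
  have hMle : ∀ j, closedIdealSpan {e j} ≤ B₂ := fun j =>
    closedIdealSpan_le hB₂ (Set.singleton_subset_iff.2 (he j).2.2.1)
  refine ⟨N, B₂, B₃, X, Q, Y, ?_, fun x hx => hA _ hx, fun x hx => hD _ hx, ?_, hfact,
    ContinuousLinearMap.ext fun x => Subtype.ext (hDD x), ?_,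
    ⟨fun x hx => hD _ hx, fun x hx hQx => Subtype.ext
      (hDstrict x x.2 hx (congrArg Subtype.val hQx))⟩,
    ⟨fun φ hφ x hx => hφ _ (hD _ hx), fun φ hφ hφQ => ?_⟩,
    ⟨fun j => closedIdealSpan {e j}, hMle,
      fun j => (D.comp (closedIdealSpan {e j}).subtypeL).codRestrict _ fun x => hinv j x x.2,
      hband, fun _ _ => rfl, fun j => ⟨?_, ?_, ?_⟩⟩, ?_⟩
  · refine isBandDecomposition_of_isClosedIdeal hL ?_ ?_ ?_
    · intro i
      fin_cases i
      exacts [hN, hB₂, hB₃]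
    · intro i j hij
      fin_cases i <;> fin_cases j
      exacts [absurd rfl hij, h12, h13, h21, absurd rfl hij, h23, h31, h32, absurd rfl hij]
    · rw [eq_top_iff]
      intro x _
      obtain ⟨b₁, h₁, b₂, h₂, b₃, h₃, rfl⟩ := hdecomp x
      exact Submodule.add_mem _ (Submodule.add_mem _
        (Submodule.mem_iSup_of_mem (p := ![N, B₂, B₃]) 0 h₁)
        (Submodule.mem_iSup_of_mem (p := ![N, B₂, B₃]) 1 h₂))
        (Submodule.mem_iSup_of_mem (p := ![N, B₂, B₃]) 2 h₃)
  · intro b₁ b₂ b₃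
    rw [hfact, map_add, map_add]
  · set D' : L →ₗ[ℝ] B₂ := (D : L →ₗ[ℝ] L).codRestrict B₂ hDmem with hD'def
    rw [← hDrank]
    refine le_antisymm ?_ ?_
    · have h : LinearMap.rank (B₂.subtype.comp (Q : B₂ →ₗ[ℝ] B₂)) =
          LinearMap.rank (Q : B₂ →ₗ[ℝ] B₂) := by
        rw [LinearMap.rank, LinearMap.range_comp, LinearMap.rank]
        exact (Submodule.equivMapOfInjective _ B₂.subtype_injective _).rank_eq.symm
      rw [← h]
      exact LinearMap.rank_comp_le_left B₂.subtype (D : L →ₗ[ℝ] L)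
    · have h : (D : L →ₗ[ℝ] L) = (B₂.subtype.comp (Q : B₂ →ₗ[ℝ] B₂)).comp D' :=
        LinearMap.ext fun x => (hDD x).symm
      rw [h]
      exact (LinearMap.rank_comp_le_left _ _).trans (LinearMap.rank_comp_le_right _ _)
  -- Extended to `L` through `p₂`, the functional kills the range of `P`. Its absolute kernel is a
  -- closed ideal, so it contains `R` and therefore `B₂`.
  · set ψ : L →L[ℝ] ℝ := φ.comp (p₂.codRestrict B₂ hp₂mem) with hψdef
    have hψ : IsPositiveOp ψ := fun x hx => hφ _ (hp₂ x hx)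
    have hψP : ∀ x, ψ (P x) = 0 := fun x => by
      have h1 : p₂.codRestrict B₂ hp₂mem (P x) = Q ⟨D x, hDmem x⟩ := Subtype.ext (hDD x).symm
      have h2 := DFunLike.congr_fun hφQ ⟨D x, hDmem x⟩
      change φ (p₂.codRestrict B₂ hp₂mem (P x)) = 0
      rw [h1]
      exact h2
    have hle : R ≤ absComap ψ hψ ⊥ bot_isClosedIdeal := by
      refine closedIdealSpan_le (absComap_isClosedIdeal _ _ _ _)
        (Set.range_subset_iff.2 fun x => ?_)
      refine mem_absComap.2 ((Submodule.mem_bot ℝ).2 (le_antisymm ?_ (hψ _ (abs_nonneg _))))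
      rw [← hψP |x|]
      exact hψ.mono (hPpos.abs_le x)
    ext x
    have h0 : ψ |(x : L)| = 0 := (Submodule.mem_bot ℝ).1 (hle x.2.2)
    have h1 : φ x = ψ x := by
      have : p₂.codRestrict B₂ hp₂mem x = x := Subtype.ext (hp₂id x x.2)
      change φ x = φ (p₂.codRestrict B₂ hp₂mem x)
      rw [this]
    have h2 := hψ.abs_le (x : L)
    rw [h0] at h2
    rw [h1]
    exact abs_nonpos_iff.1 h2
  · exact ContinuousLinearMap.ext fun x => Subtype.ext (hDD x)
  · set v : closedIdealSpan {e j} := ⟨e j, mem_closedIdealSpan_singleton _⟩ with hv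
    rw [LinearMap.rank]
    have hrange : LinearMap.range (((D.comp (closedIdealSpan {e j}).subtypeL).codRestrict
        (closedIdealSpan {e j}) fun x => hinv j x x.2 :
          closedIdealSpan {e j} →L[ℝ] closedIdealSpan {e j}) :
          closedIdealSpan {e j} →ₗ[ℝ] closedIdealSpan {e j}) = Submodule.span ℝ {v} := by
      refine le_antisymm ?_ ?_
      · rintro _ ⟨x, rfl⟩
        obtain ⟨c, hc⟩ := Submodule.mem_span_singleton.1 (hone j x x.2)
        exact Submodule.mem_span_singleton.2 ⟨c, Subtype.ext hc⟩
      · rw [Submodule.span_singleton_le_iff_mem]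
        exact ⟨v, Subtype.ext (he j).2.2.2⟩
    rw [hrange, Module.rank_eq_one_iff_finrank_eq_one]
    exact finrank_span_singleton fun h => (he j).2.1 (congrArg Subtype.val h)
  · exact ⟨fun x hx => hD _ hx, fun x hx hQx => Subtype.ext
      (hDstrict x (hMle j x.2) hx (congrArg Subtype.val hQx))⟩
  · rintro ⟨C, hC, hCP⟩
    have hMspan : ∀ j, closedIdealSpan {e j} ≤ Submodule.span ℝ {e j} := by
      intro j
      refine closedIdealSpan_le_span_of_maximal_chain hC (he j).1 fun J hJC u hu huJ hu0 => ?_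
      have hJ := hC.prop.2 J hJC
      have huM := (closedIdealSpan_isClosedIdeal ({e j} : Set L)).1.abs_mem hu
      obtain ⟨c, hc⟩ := Submodule.mem_span_singleton.1 (hone j _ huM)
      -- `J` is invariant under `P` only, but `|D |u|| ≤ |P |u||` and `J` is an ideal. As `D |u|` is
      -- a nonzero multiple of `e j`, this places `e j` in `J`.
      have hDJ : D |u| ∈ J :=
        hJ.1 _ _ (hp₂abs (P |u|)) (hCP J hJC P rfl _ (hJ.1.abs_mem huJ))
      have hc0 : c ≠ 0 := by
        rintro rfl
        rw [zero_smul] at hc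
        exact hu0 (eq_zero_of_abs_eq_zero
          (hDstrict _ (hMle j huM) (abs_nonneg u) hc.symm))
      rw [← hc] at hDJ
      exact (J.smul_mem_iff hc0).1 hDJ
    have hfix : ∀ x ∈ B₂, D x = x := by
      have hle : B₂ ≤ LinearMap.eqLocus (D : L →ₗ[ℝ] L) LinearMap.id := by
        rw [← hband.2.2.2]
        refine iSup_le fun j => (hMspan j).trans ?_
        rw [Submodule.span_singleton_le_iff_mem]
        exact (he j).2.2.2
      exact fun x hx => hle hx
    refine ⟨?_, ContinuousLinearMap.ext fun x => Subtype.ext (hfix x x.2)⟩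
    have hfd : FiniteDimensional ℝ (Submodule.span ℝ (Set.range e)) :=
      FiniteDimensional.span_of_finite ℝ (Set.finite_range e)
    exact Submodule.finiteDimensional_of_le fun x hx => hfix x hx ▸ hspan x
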